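/- **The scheme $\mathrm{pWSAh}$.** There are $M$ agents $1,\dots,M$, an aggregator $a$ and $T$ time steps, where $M$ and $T$ are constants or, more generally, are bounded by polynomials in the security parameter $\kappa$. - $\mathrm{Setup}$: generate (with an arbitrary distribution) two primes $p,q$ with the same number of bits such that $N=pq$ satisfies $\lfloor\log_2N\rfloor=\kappa$ and $\gcd(\phi(N),N)=1$ (the condition $\lfloor\log_2N\rfloor=\kappa$ is required for all sufficiently large $\kappa$, since for some small $\kappa$ there are no such primes). For all $i\in[M]$ and $t\in[T]$ draw $s_i(t)\in(\mathbb Z/N\mathbb Z)^*$ uniformly and independently, and set $s_a(t)=-\sum_{i\in[M]}s_i(t)\in\mathbb Z/N\mathbb Z$. Put $\mathrm{prm}=(\kappa,N)$, $\mathrm{sk}_i=(s_i(t))_{t\in[T]}$ and $\mathrm{sk}_a=\big((\phi(N),\phi(N)^{-1}\bmod N),(s_a(t))_{t\in[T]}\big)$. - Paillier encryption of $x\in\mathbb Z/N\mathbb Z$ is $\mathrm E(x)=(1+N)^xr^N\bmod N^2$ with a fresh uniform $r\in(\mathbb Z/N\mathbb Z)^*$; decryption is $\mathrm D(c)=\frac{(c^{\phi(N)}\bmod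 N^2)-1}{N}\,\phi(N)^{-1}\bmod N$. - $\mathrm{InitW}$: for a weight $w_i\in\mathbb Z/N\mathbb Z$ of agent $i$, output $\mathrm{sw}_i=\mathrm E(w_i)$. - $\mathrm{Enc}$: for $x_i(t)\in\mathbb Z/N\mathbb Z$, output $c_i(t)=\mathrm{sw}_i^{\,x_i(t)}\cdot\mathrm E(s_i(t))\bmod N^2$. - $\mathrm{AggrDec}$: output $x_a(t)=\mathrm D\big(\prod_{i\in[M]}c_i(t)\big)+s_a(t)\bmod N$. **The game $\mathrm{pWSAO}$.** The challenger runs $\mathrm{Setup}$ and gives $\mathrm{prm}$ to the adversary $\mathcal A$, a randomized interactive algorithm. At any time $\mathcal A$ may adaptively make - compromise queries: it names a participant $j\in[M]\cup\{a\}$ and receives $\mathrm{sk}_j$; $\mathcal C$ denotes the set of participants compromised by the end of the game; - encryption queries $(i,t,\{w_i^0,w_i^1\},x)$ with $i\in[M]$: it receives $\mathrm{Enc}$ of $x$ for agent $i$ at time $t$, once under $\mathrm{InitW}(w_i^0)$ and once under $\mathrm{InitW}(w_i^1)$; $\mathcal E(t)$ denotes the set of agents queried at time $t$ by the end of the game.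 At most one such query is allowed for each pair $(i,t)$. Once in the game, $\mathcal A$ submits a challenge: a time step $t^*$, a set $\mathcal S^*\subseteq\mathcal U^*:=([M]\cup\{a\})\setminus(\mathcal C\cup\mathcal E(t^*))$, and for each agent $i\in\mathcal S^*\setminus\{a\}$ two weights $w_i^0,w_i^1$ and two values $x_i^0,x_i^1$. The two weights of an agent must be the same in all encryption queries and in the challenge. If $\mathcal S^*=\mathcal U^*$ and $a\notin\mathcal S^*$, then it is required that $\sum_{i\in\mathcal S^*}w_i^0x_i^0=\sum_{i\in\mathcal S^*}w_i^1x_i^1$ in $\mathbb Z/N\mathbb Z$. The challenger draws a uniform bit $b$ and returns $\mathrm{Enc}$ of $x_i^b$ for agent $i$ at time $t^*$ under $\mathrm{InitW}(w_i^b)$, for all agents $i\in\mathcal S^*\setminus\{a\}$. At the end $\mathcal A$ outputs a guess $b'\in\{0,1\}$; if one of the rules was violated, $b'$ is replaced by a fair coin toss. The advantage of $\mathcal A$ is $\mathrm{Adv}(\mathcal A)=\left|\Pr[b'=b]-\tfrac12\right|$. **Theorem.** The scheme $\mathrm{pWSAh}$ achieves weighted sum aggregator obliviousness: for every adversary $\mathcal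 A$ (in particular for every probabilistic polynomial-time one, but no bound on its computational power is needed), which may compromise the aggregator and any set of agents, there is a negligible function $\eta$ such that $\mathrm{Adv}(\mathcal A)\le\eta(\kappa)$ for all $\kappa$. Here $\eta$ is negligible if for every real $c>0$ there is $n_c$ with $|\eta(n)|\le n^{-c}$ for all integers $n\ge n_c$. -/

import Mathlib

namespace PWSA

/-! ### Asymptotics -/

/-- A function `η` of the security parameter is negligible if it is eventually
bounded by `n ^ (-c)`, for every real `c > 0`. -/
def Negligible (η : ℕ → ℝ) : Prop :=
  ∀ c : ℝ, 0 < c → ∃ n₀ : ℕ, 1 ≤ n₀ ∧ ∀ n : ℕ, n₀ ≤ n → |η n| ≤ (n : ℝ) ^ (-c)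

/-- A size parameter is bounded by a polynomial in the security parameter
(every constant is). -/
def PolyBounded (f : ℕ → ℕ) : Prop :=
  ∃ P : Polynomial ℕ, ∀ κ : ℕ, f κ ≤ P.eval κ

/-- Independent samples from a finite family of distributions. -/
noncomputable def indep {α : Type} : {n : ℕ} → (Fin n → PMF α) → PMF (Fin n → α)
  | 0, _ => PMF.pure Fin.elim0
  | _ + 1, p => (p 0).bind fun a => (indep fun i => p i.succ).map (Fin.cons a)

/-! ### Private weighted sum aggregation schemes with hidden weights -/

/-- Syntax of a private weighted sum aggregation scheme with hidden weights, for a fixed security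
parameter, `M` agents and `T` time steps.  The spaces may depend on the public
parameters (for instance on a modulus contained in them). -/
structure Scheme (M T : ℕ) where
  /-- public parameters `prm` -/
  Prm : Type
  /-- space of local values and of weights -/
  Msg : Prm → Type
  [ring : ∀ prm, CommRing (Msg prm)]
  /-- space of the agents' secret information `sk_i` -/
  AgentKey : Prm → Type
  /-- space of the aggregator's secret information `sk_a` -/
  AggrKey : Prm → Type
  /-- space of the protected weights `sw_i` -/
  HiddenWeight : Prm → Type
  /-- space of ciphertexts -/
  Cipher : Prm → Type
  /-- `Setup`, which outputs `prm`, all `sk_i`, and `sk_a` -/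
  setup : PMF (Σ prm : Prm, (Fin M → AgentKey prm) × AggrKey prm)
  /-- `InitW(prm, i, w)` -/
  initW : (prm : Prm) → Fin M → Msg prm → PMF (HiddenWeight prm)
  /-- `Enc(prm, sw_i, sk_i, t, x)` -/
  enc : (prm : Prm) → HiddenWeight prm → AgentKey prm → Fin T → Msg prm → PMF (Cipher prm)
  /-- `AggrDec(prm, sk_a, t, (c_i)_i)` -/
  aggrDec : (prm : Prm) → AggrKey prm → Fin T → (Fin M → Cipher prm) → Msg prm

attribute [instance] Scheme.ring

/-! ### The adversary's side of the game

Participants are `Option (Fin M)`: `some i` is agent `i`, `none` is the aggregator. -/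

/-- An encryption query `(i, t, {w⁰, w¹}, x)`; `w false` is `w⁰` and `w true` is `w¹`. -/
structure EncQuery (M T : ℕ) (X : Type) where
  agent : Fin M
  time : Fin T
  w : Bool → X
  x : X

/-- A challenge: the time step `t⋆`, the set `S⋆` of participants, and for each bit the
weights and values of the agents (only those of the agents in `S⋆` matter). -/
structure Challenge (M T : ℕ) (X : Type) where
  time : Fin T
  S : Finset (Option (Fin M))
  w : Bool → Fin M → X
  x : Bool → Fin M → X

/-- A randomized interactive algorithm that may toss coins, compromise agents and the
aggregator, make encryption queries (each answered by two ciphertexts, one per weight), all of it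
adaptively, and that finally outputs an element of `R`.
Here `X`, `K`, `KA`, `C` are the spaces of values, agents' keys, aggregator's keys, ciphertexts.
No bound is put on the computational power, so that every probabilistic
polynomial-time algorithm is covered. -/
inductive Interaction (M T : ℕ) (X K KA C R : Type) : Type
  | output (r : R)
  | sample (p : PMF ℕ) (next : ℕ → Interaction M T X K KA C R)
  | compromiseAgent (i : Fin M) (next : K → Interaction M T X K KA C R)
  | compromiseAggregator (next : KA → Interaction M T X K KA C R)
  | encrypt (q : EncQuery M T X) (next : C × C → Interaction M T X K KA C R)

/-- An interaction with a given scheme and given public parameters. -/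
abbrev Scheme.Interacts {M T : ℕ} (𝒮 : Scheme M T) (prm : 𝒮.Prm) (R : Type) : Type :=
  Interaction M T (𝒮.Msg prm) (𝒮.AgentKey prm) (𝒮.AggrKey prm) (𝒮.Cipher prm) R

/-- The answer to a challenge: a ciphertext for each agent in `S⋆`, nothing for the others. -/
abbrev Scheme.Answer {M T : ℕ} (𝒮 : Scheme M T) (prm : 𝒮.Prm) : Type :=
  Fin M → Option (𝒮.Cipher prm)

/-- An adversary: given the public parameters, it makes queries, then submits one challenge; given
the answer, it may make further queries, and outputs its guess. -/
abbrev Scheme.Adversary {M T : ℕ} (𝒮 : Scheme M T) : Type :=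
  (prm : 𝒮.Prm) →
    𝒮.Interacts prm (Challenge M T (𝒮.Msg prm) × (𝒮.Answer prm → 𝒮.Interacts prm Bool))

/-- What the challenger records: the set `𝒞` of compromised participants and the
encryption queries. -/
structure Log (M T : ℕ) (X : Type) where
  corrupted : Finset (Option (Fin M))
  queries : List (EncQuery M T X)

namespace Log

variable {M T : ℕ} {X : Type}

/-- The log at the beginning of the game. -/
def empty : Log M T X := ⟨∅, []⟩

/-- Record that participant `j` is compromised. -/
def corrupt (L : Log M T X) (j : Option (Fin M)) : Log M T X :=
  ⟨insert j L.corrupted, L.queries⟩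

/-- Record an encryption query. -/
def record (L : Log M T X) (q : EncQuery M T X) : Log M T X :=
  ⟨L.corrupted, q :: L.queries⟩

/-- The set `ℰ(t)` of participants for which an encryption query was made at time `t`. -/
def encrypted (L : Log M T X) (t : Fin T) : Finset (Option (Fin M)) :=
  ((L.queries.filter fun q => q.time = t).map fun q => some q.agent).toFinset

/-- The set `𝒰⋆ = ([M] ∪ {a}) \ (𝒞 ∪ ℰ(t⋆))`. -/
def untouched (L : Log M T X) (t : Fin T) : Finset (Option (Fin M)) :=
  Finset.univ \ (L.corrupted ∪ L.encrypted t)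

end Log

/-- The rules of the game, checked on the log at the end of the game. -/
structure Legal {M T : ℕ} {X : Type} [CommRing X] (ch : Challenge M T X) (L : Log M T X) :
    Prop where
  /-- at most one encryption query per agent and time step -/
  once : (L.queries.map fun q => (q.agent, q.time)).Nodup
  /-- the two weights of each agent are constant over the encryption queries … -/
  weights : ∀ q ∈ L.queries, ∀ q' ∈ L.queries, q.agent = q'.agent → q.w = q'.w
  /-- … and are those used in the challenge -/
  challengeWeights : ∀ q ∈ L.queries, some q.agent ∈ ch.S → ∀ b, q.w b = ch.w b q.agent
  /-- `S⋆ ⊆ 𝒰⋆` -/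
  subset : ch.S ⊆ L.untouched ch.time
  /-- equal weighted sums, if `S⋆ = 𝒰⋆` and the aggregator is not in `S⋆` -/
  balanced : ch.S = L.untouched ch.time → none ∉ ch.S →
    ∑ i with some i ∈ ch.S, ch.w false i * ch.x false i =
      ∑ i with some i ∈ ch.S, ch.w true i * ch.x true i

/-! ### The challenger's side of the game -/

namespace Scheme

variable {M T : ℕ} (𝒮 : Scheme M T)

/-- A fresh protection of the weight `w` of agent `i`, followed by the encryption of `x`. -/
noncomputable def freshEnc (prm : 𝒮.Prm) (sk : Fin M → 𝒮.AgentKey prm) (i : Fin M) (t : Fin T)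
    (w x : 𝒮.Msg prm) : PMF (𝒮.Cipher prm) :=
  (𝒮.initW prm i w).bind fun sw => 𝒮.enc prm sw (sk i) t x

/-- Execution of an interaction against the challenger, who holds all the secret keys. -/
noncomputable def run {R : Type} (prm : 𝒮.Prm) (sk : Fin M → 𝒮.AgentKey prm)
    (ska : 𝒮.AggrKey prm) :
    𝒮.Interacts prm R → Log M T (𝒮.Msg prm) → PMF (R × Log M T (𝒮.Msg prm))
  | .output r, L => PMF.pure (r, L)
  | .sample p next, L => p.bind fun n => run prm sk ska (next n) L
  | .compromiseAgent i next, L => run prm sk ska (next (sk i)) (L.corrupt (some i))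
  | .compromiseAggregator next, L => run prm sk ska (next ska) (L.corrupt none)
  | .encrypt q next, L =>
      (𝒮.freshEnc prm sk q.agent q.time (q.w false) q.x).bind fun c₀ =>
        (𝒮.freshEnc prm sk q.agent q.time (q.w true) q.x).bind fun c₁ =>
          run prm sk ska (next (c₀, c₁)) (L.record q)

/-- The challenger's answer to a challenge, for the bit `b`. -/
noncomputable def answer (prm : 𝒮.Prm) (sk : Fin M → 𝒮.AgentKey prm)
    (ch : Challenge M T (𝒮.Msg prm)) (b : Bool) : PMF (𝒮.Answer prm) :=
  indep fun i =>
    if some i ∈ ch.S then (𝒮.freshEnc prm sk i ch.time (ch.w b i) (ch.x b i)).map some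
    else PMF.pure none

open Classical in
/-- The game; the outcome `true` means that the guess is correct.
A play against the rules is worth a fair coin toss, i.e. it gives no advantage. -/
noncomputable def game (A : 𝒮.Adversary) : PMF Bool :=
  𝒮.setup.bind fun keys =>
    (𝒮.run keys.1 keys.2.1 keys.2.2 (A keys.1) Log.empty).bind fun s =>
      (PMF.uniformOfFintype Bool).bind fun b =>
        (𝒮.answer keys.1 keys.2.1 s.1.1 b).bind fun c =>
          (𝒮.run keys.1 keys.2.1 keys.2.2 (s.1.2 c) s.2).bind fun g =>
            if Legal s.1.1 g.2 then PMF.pure (g.1 == b) else PMF.uniformOfFintype Bool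

/-- The advantage `|Pr[b' = b] - 1/2|`. -/
noncomputable def advantage (A : 𝒮.Adversary) : ℝ :=
  |(𝒮.game A true).toReal - 1 / 2|

end Scheme

/-- Weighted sum aggregator obliviousness of a scheme (a family indexed by the security
parameter `κ`): no adversary has more than negligible advantage.  The adversaries
are all randomized interactive algorithms, whatever their running time. -/
def AggregatorOblivious {M T : ℕ → ℕ} (𝒮 : (κ : ℕ) → Scheme (M κ) (T κ)) : Prop :=
  ∀ A : (κ : ℕ) → (𝒮 κ).Adversary,
    ∃ η : ℕ → ℝ, Negligible η ∧ ∀ κ, (𝒮 κ).advantage (A κ) ≤ η κ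

/-! ### The Paillier cryptosystem -/

/-- Two primes of equal size (number of bits) whose product `N` satisfies `gcd(φ(N), N) = 1`. -/
structure PaillierPrimes where
  p : ℕ
  q : ℕ
  prime_p : p.Prime
  prime_q : q.Prime
  equal_size : p.size = q.size
  coprime : Nat.gcd (Nat.totient (p * q)) (p * q) = 1

/-- The modulus `N = p q`. -/
def PaillierPrimes.modulus (k : PaillierPrimes) : ℕ+ :=
  ⟨k.p * k.q, Nat.mul_pos k.prime_p.pos k.prime_q.pos⟩

/-- `E(x; r) = (1 + N) ^ x * r ^ N mod N²`. -/
def paillierEncWith (N : ℕ+) (x : ZMod N) (r : (ZMod N)ˣ) : ZMod ((N : ℕ) ^ 2) :=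
  (1 + ((N : ℕ) : ZMod ((N : ℕ) ^ 2))) ^ x.val *
    (((r : ZMod N).val : ℕ) : ZMod ((N : ℕ) ^ 2)) ^ (N : ℕ)

/-- `E(x)`, with `r` uniform in `(ℤ/N)ˣ`. -/
noncomputable def paillierEnc (N : ℕ+) (x : ZMod N) : PMF (ZMod ((N : ℕ) ^ 2)) :=
  (PMF.uniformOfFintype (ZMod N)ˣ).map (paillierEncWith N x)

/-- The secret key `(φ(N), φ(N)⁻¹ mod N)`. -/
def paillierSecret (N : ℕ+) : ℕ × ZMod N :=
  (Nat.totient N, ((Nat.totient N : ℕ) : ZMod N)⁻¹)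

/-- `D(c) = (c ^ φ(N) - 1) / N * φ(N)⁻¹ mod N`. -/
def paillierDec (N : ℕ+) (sec : ℕ × ZMod N) (c : ZMod ((N : ℕ) ^ 2)) : ZMod N :=
  ((((c ^ sec.1).val - 1) / (N : ℕ) : ℕ) : ZMod N) * sec.2

/-! ### The scheme -/

/-- The aggregator's shares `s_a(t) = - ∑ i, s_i(t)`. -/
def aggregatorShare {M T : ℕ} (N : ℕ+) (s : Fin M → Fin T → (ZMod N)ˣ) (t : Fin T) : ZMod N :=
  -∑ i, (s i t : ZMod N)

/-- The scheme with Paillier-encrypted weights and with fresh shares of zero in each time step, for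
the security parameter `κ` and the distribution `gen` of the two primes.  The
public parameters are `(κ, N)`; the shares `s_i(t)` are independent and uniform in `(ℤ/N)ˣ`. -/
noncomputable def pWSAh (gen : PMF PaillierPrimes) (κ M T : ℕ) : Scheme M T where
  Prm := ℕ × ℕ+
  Msg prm := ZMod prm.2
  ring _ := inferInstance
  AgentKey prm := Fin T → (ZMod prm.2)ˣ
  AggrKey prm := (ℕ × ZMod prm.2) × (Fin T → ZMod prm.2)
  HiddenWeight prm := ZMod ((prm.2 : ℕ) ^ 2)
  Cipher prm := ZMod ((prm.2 : ℕ) ^ 2)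
  setup := gen.bind fun k =>
    (PMF.uniformOfFintype (Fin M → Fin T → (ZMod k.modulus)ˣ)).map fun s =>
      ⟨(κ, k.modulus), s, (paillierSecret k.modulus, aggregatorShare k.modulus s)⟩
  initW prm _ w := paillierEnc prm.2 w
  enc prm sw sk t x := (paillierEnc prm.2 (sk t : ZMod prm.2)).map fun c => sw ^ x.val * c
  aggrDec prm ska t c := paillierDec prm.2 ska.1 (∏ i, c i) + ska.2 t

end PWSA

namespace PWSA

open scoped ENNReal

/-! By the homomorphic property, a ciphertext of `x` under weight `w` and share `s` has the law of a
fresh Paillier encryption of `w * x + s` (`paillierEnc_bind`). Only the sum `w * x + s` matters.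

Suppose the shares were uniform in all of `ZMod N`. Fix an outcome: challenge, guess and final log.
If it is legal, some shift `δ` of the shares vanishes on everything revealed and compensates for the
change of challenge (`Legal.exists_shift`). Translation by `δ` permutes the shares, so the outcome
has the same total weight for both bits, and the game is an exact coin toss (`sum_shareGame`).
Adaptivity is no obstacle, because the comparison is made for one fixed final log
(`Oracle.AgreeOn.play_apply_eq`).

The actual shares are units, a fraction `(φ(N)/N) ^ (M * T)` of all tuples. Restricting to them
raises the probability of either outcome to at most `1/2 + M * T * (1 - φ(N)/N)`. As `p` and `q`
have equal size, `1 - φ(N)/N` is at most `4 / √2 ^ κ`, which is negligible even after multiplication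
by a polynomial. No computational assumption enters. -/

/-! ### Interactions with an abstract challenger -/

/-- What an interaction can obtain from a challenger: the secret information of each
participant, and the law of the encryption of `x` under the weight `w` for each agent and time. -/
structure Oracle (M T : ℕ) (X K KA C : Type) where
  key : Fin M → K
  aggr : KA
  enc : Fin M → Fin T → X → X → PMF C

section Oracle

variable {M T : ℕ} {X K KA C : Type}

instance : Preorder (Log M T X) where
  le L L' := L.corrupted ⊆ L'.corrupted ∧ L.queries ⊆ L'.queries
  le_refl _ := ⟨Finset.Subset.refl _, List.Subset.refl _⟩
  le_trans _ _ _ h h' := ⟨Finset.Subset.trans h.1 h'.1, List.Subset.trans h.2 h'.2⟩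

theorem Log.le_corrupt (L : Log M T X) (j : Option (Fin M)) : L ≤ L.corrupt j :=
  ⟨Finset.subset_insert _ _, List.Subset.refl _⟩

theorem Log.le_record (L : Log M T X) (q : EncQuery M T X) : L ≤ L.record q :=
  ⟨Finset.Subset.refl _, List.subset_cons_self _ _⟩

namespace Oracle

/-- Execution of an interaction against an abstract challenger. -/
noncomputable def run {R : Type} (O : Oracle M T X K KA C) :
    Interaction M T X K KA C R → Log M T X → PMF (R × Log M T X)
  | .output r, L => PMF.pure (r, L)
  | .sample p next, L => p.bind fun n => run O (next n) L
  | .compromiseAgent i next, L => run O (next (O.key i)) (L.corrupt (some i))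
  | .compromiseAggregator next, L => run O (next O.aggr) (L.corrupt none)
  | .encrypt q next, L =>
      (O.enc q.agent q.time (q.w false) q.x).bind fun c₀ =>
        (O.enc q.agent q.time (q.w true) q.x).bind fun c₁ =>
          run O (next (c₀, c₁)) (L.record q)

/-- The answer to a challenge. -/
noncomputable def answer (O : Oracle M T X K KA C) (ch : Challenge M T X) (b : Bool) :
    PMF (Fin M → Option C) :=
  indep fun i =>
    if some i ∈ ch.S then (O.enc i ch.time (ch.w b i) (ch.x b i)).map some else PMF.pure none

/-- The game for a fixed bit; it returns the challenge, the guess and the final log. -/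
noncomputable def play (O : Oracle M T X K KA C)
    (I : Interaction M T X K KA C
      (Challenge M T X × ((Fin M → Option C) → Interaction M T X K KA C Bool)))
    (b : Bool) : PMF (Challenge M T X × Bool × Log M T X) :=
  (O.run I Log.empty).bind fun s => (O.answer s.1.1 b).bind fun c =>
    (O.run (s.1.2 c) s.2).bind fun g => PMF.pure (s.1.1, g.1, g.2)

/-- Two challengers agree on everything that is recorded in a log. -/
structure AgreeOn (O O' : Oracle M T X K KA C) (L : Log M T X) : Prop where
  key : ∀ i, some i ∈ L.corrupted → O.key i = O'.key i
  aggr : none ∈ L.corrupted → O.aggr = O'.aggr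
  enc : ∀ q ∈ L.queries, O.enc q.agent q.time = O'.enc q.agent q.time

theorem AgreeOn.mono {O O' : Oracle M T X K KA C} {L L' : Log M T X} (h : O.AgreeOn O' L')
    (hL : L ≤ L') : O.AgreeOn O' L :=
  ⟨fun i hi => h.key i (hL.1 hi), fun hi => h.aggr (hL.1 hi), fun q hq => h.enc q (hL.2 hq)⟩

theorem le_of_mem_support_run {R : Type} (O : Oracle M T X K KA C)
    (I : Interaction M T X K KA C R) (L : Log M T X) (s : R × Log M T X)
    (h : s ∈ (O.run I L).support) : L ≤ s.2 := by
  induction I generalizing L with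
  | output r =>
    simp only [run, PMF.support_pure, Set.mem_singleton_iff] at h
    subst h
    exact le_refl L
  | sample p next ih =>
    simp only [run, PMF.mem_support_bind_iff] at h
    obtain ⟨n, -, hn⟩ := h
    exact ih n L hn
  | compromiseAgent i next ih => exact le_trans (L.le_corrupt _) (ih _ _ h)
  | compromiseAggregator next ih => exact le_trans (L.le_corrupt _) (ih _ _ h)
  | encrypt q next ih =>
    simp only [run, PMF.mem_support_bind_iff] at h
    obtain ⟨c₀, -, c₁, -, hc⟩ := h
    exact le_trans (L.le_record _) (ih _ _ hc)

theorem run_apply_eq_zero {R : Type} (O : Oracle M T X K KA C)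
    (I : Interaction M T X K KA C R) (L : Log M T X) (s : R × Log M T X)
    (h : ¬ L ≤ s.2) : O.run I L s = 0 := by
  by_contra h'
  exact h (O.le_of_mem_support_run I L s ((PMF.mem_support_iff _ _).2 h'))

/-- Logs only grow, so on a branch that ends in `s` every answer received is recorded in `s.2`,
where the challengers agree. All other branches contribute zero on both sides. -/
theorem AgreeOn.run_apply_eq {R : Type} {O O' : Oracle M T X K KA C}
    (I : Interaction M T X K KA C R) (L : Log M T X) (s : R × Log M T X)
    (h : O.AgreeOn O' s.2) : O.run I L s = O'.run I L s := by
  induction I generalizing L with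
  | output r => rfl
  | sample p next ih =>
    simp only [run, PMF.bind_apply]
    exact tsum_congr fun n => by rw [ih]
  | compromiseAgent i next ih =>
    by_cases hL : L.corrupt (some i) ≤ s.2
    · have hk : O.key i = O'.key i := h.key i (hL.1 (Finset.mem_insert_self _ _))
      simp only [run, hk]
      exact ih _ _
    · simp only [run, run_apply_eq_zero _ _ _ _ hL]
  | compromiseAggregator next ih =>
    by_cases hL : L.corrupt none ≤ s.2
    · have hk : O.aggr = O'.aggr := h.aggr (hL.1 (Finset.mem_insert_self _ _))
      simp only [run, hk]
      exact ih _ _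
    · simp only [run, run_apply_eq_zero _ _ _ _ hL]
  | encrypt q next ih =>
    by_cases hL : L.record q ≤ s.2
    · have hk := h.enc q (hL.2 List.mem_cons_self)
      simp only [run, PMF.bind_apply, hk]
      refine tsum_congr fun c₀ => ?_
      congr 1
      exact tsum_congr fun c₁ => by rw [ih]
    · simp only [run, PMF.bind_apply, run_apply_eq_zero _ _ _ _ hL, mul_zero, tsum_zero]

/-- The bit enters a play only through the answer to the challenge, so the two bits may differ.
Intermediate states with another challenge, or with a log not below the final one, have no weight.
-/
theorem AgreeOn.play_apply_eq {O O' : Oracle M T X K KA C}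
    (I : Interaction M T X K KA C
      (Challenge M T X × ((Fin M → Option C) → Interaction M T X K KA C Bool)))
    (b b' : Bool) (o : Challenge M T X × Bool × Log M T X) (h : O.AgreeOn O' o.2.2)
    (hans : O.answer o.1 b = O'.answer o.1 b') : O.play I b o = O'.play I b' o := by
  obtain ⟨ch, g, L⟩ := o
  change O.AgreeOn O' L at h
  simp only [play, PMF.bind_apply (p := run _ _ _)]
  refine tsum_congr fun s => ?_
  by_cases hs : s.1.1 = ch
  · subst hs
    by_cases hL : s.2 ≤ L
    · rw [(h.mono hL).run_apply_eq, hans]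
      congr 1
      simp only [PMF.bind_apply]
      refine tsum_congr fun c => ?_
      congr 1
      refine tsum_congr fun r => ?_
      by_cases hr : r.2 = L
      · rw [AgreeOn.run_apply_eq _ _ r (hr ▸ h)]
      · have : PMF.pure (s.1.1, r.1, r.2) (s.1.1, g, L) = 0 := by
          rw [PMF.pure_apply, if_neg]
          intro e
          simp only [Prod.mk.injEq] at e
          exact hr e.2.2.symm
        rw [this, mul_zero, mul_zero]
    · have key : ∀ (Q : Oracle M T X K KA C) (b : Bool),
          ((Q.answer s.1.1 b).bind fun c => (Q.run (s.1.2 c) s.2).bind fun g =>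
            PMF.pure (s.1.1, g.1, g.2)) (s.1.1, g, L) = 0 := by
        intro Q b
        rw [PMF.apply_eq_zero_iff]
        simp only [PMF.mem_support_bind_iff, PMF.support_pure, Set.mem_singleton_iff,
          Prod.mk.injEq, not_exists, not_and]
        rintro c - r hr - - rfl
        exact hL (Q.le_of_mem_support_run _ _ _ hr)
      rw [key, key, mul_zero, mul_zero]
  · have key : ∀ (Q : Oracle M T X K KA C) (b : Bool),
        ((Q.answer s.1.1 b).bind fun c => (Q.run (s.1.2 c) s.2).bind fun g =>
          PMF.pure (s.1.1, g.1, g.2)) (ch, g, L) = 0 := by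
      intro Q b
      rw [PMF.apply_eq_zero_iff]
      simp only [PMF.mem_support_bind_iff, PMF.support_pure, Set.mem_singleton_iff,
        Prod.mk.injEq, not_exists, not_and]
      rintro c - r - h' -
      exact absurd h'.symm hs
    rw [key, key, mul_zero, mul_zero]

end Oracle

end Oracle

theorem Scheme.run_eq {M T : ℕ} (𝒮 : Scheme M T) {R : Type} (prm : 𝒮.Prm)
    (sk : Fin M → 𝒮.AgentKey prm) (ska : 𝒮.AggrKey prm) (I : 𝒮.Interacts prm R)
    (L : Log M T (𝒮.Msg prm)) :
    𝒮.run prm sk ska I L = Oracle.run ⟨sk, ska, 𝒮.freshEnc prm sk⟩ I L := by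
  induction I generalizing L with
  | output r => rfl
  | sample p next ih => simp only [Scheme.run, Oracle.run, ih]
  | compromiseAgent i next ih => simp only [Scheme.run, Oracle.run, ih]
  | compromiseAggregator next ih => simp only [Scheme.run, Oracle.run, ih]
  | encrypt q next ih => simp only [Scheme.run, Oracle.run, ih]

/-! ### The law of a ciphertext -/

theorem one_add_pow_self (N : ℕ) : (1 + (N : ZMod (N ^ 2))) ^ N = 1 := by
  have h := dvd_sub_pow_of_dvd_sub (R := ZMod (N ^ 2)) (p := N) (a := 1 + (N : ZMod (N ^ 2)))
    (b := 1) (by simp) 1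
  have h0 : ((N : ZMod (N ^ 2)) ^ (1 + 1)) = 0 := by
    exact_mod_cast ZMod.natCast_self (N ^ 2)
  rw [h0, zero_dvd_iff, pow_one, one_pow, sub_eq_zero] at h
  exact h

theorem one_add_pow_congr {N m n : ℕ} (h : m ≡ n [MOD N]) :
    (1 + (N : ZMod (N ^ 2))) ^ m = (1 + (N : ZMod (N ^ 2))) ^ n :=
  pow_eq_pow_of_modEq h (one_add_pow_self N)

/-- Raising to the power `N` lifts a congruence modulo `N` to one modulo `N ^ 2`. Hence the choice
of representative of the randomness `r` does not affect `r ^ N`. -/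
theorem natCast_pow_congr {N m n : ℕ} (h : m ≡ n [MOD N]) :
    (m : ZMod (N ^ 2)) ^ N = (n : ZMod (N ^ 2)) ^ N := by
  have hd : ((N : ℤ)) ∣ (m : ℤ) - n := (Nat.modEq_iff_dvd.1 h.symm)
  have h2 := dvd_sub_pow_of_dvd_sub (R := ℤ) (p := N) hd 1
  rw [pow_one, show (1 + 1) = 2 from rfl] at h2
  have h3 : ((N ^ 2 : ℕ) : ℤ) ∣ (m : ℤ) ^ N - n ^ N := by exact_mod_cast h2
  have h4 := (ZMod.intCast_zmod_eq_zero_iff_dvd _ _).2 h3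
  push_cast at h4
  exact sub_eq_zero.1 h4

theorem paillierEncWith_pow_mul (N : ℕ+) (w x s : ZMod N) (r r' : (ZMod N)ˣ) :
    paillierEncWith N w r ^ x.val * paillierEncWith N s r' =
      paillierEncWith N (w * x + s) (r ^ x.val * r') := by
  have h1 : (w * x + s).val ≡ w.val * x.val + s.val [MOD N] := by
    rw [← ZMod.natCast_eq_natCast_iff]
    simp
  have h2 : ((r ^ x.val * r' : (ZMod N)ˣ) : ZMod N).val ≡
      (r : ZMod N).val ^ x.val * (r' : ZMod N).val [MOD N] := by
    rw [← ZMod.natCast_eq_natCast_iff]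
    simp
  unfold paillierEncWith
  rw [one_add_pow_congr h1, natCast_pow_congr h2]
  push_cast
  ring

theorem uniformOfFintype_map_equiv {α : Type} [Fintype α] [Nonempty α] (e : α ≃ α) :
    (PMF.uniformOfFintype α).map e = PMF.uniformOfFintype α := by
  ext a
  rw [PMF.map_apply, tsum_eq_single (e.symm a)]
  · simp
  · intro b hb
    rw [if_neg]
    rintro rfl
    simp at hb

/-- For each fixed randomness `r` of the weight, `r' ↦ r ^ x.val * r'` permutes the units, so the
combined randomness is uniform whatever `r` is. -/
theorem paillierEnc_bind (N : ℕ+) (w x s : ZMod N) :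
    ((paillierEnc N w).bind fun sw => (paillierEnc N s).map fun c => sw ^ x.val * c) =
      paillierEnc N (w * x + s) := by
  unfold paillierEnc
  rw [PMF.bind_map]
  have : ∀ r : (ZMod N)ˣ,
      ((PMF.uniformOfFintype (ZMod N)ˣ).map (paillierEncWith N s)).map
        (fun c => paillierEncWith N w r ^ x.val * c) =
      (PMF.uniformOfFintype (ZMod N)ˣ).map (paillierEncWith N (w * x + s)) := by
    intro r
    conv_rhs => rw [← uniformOfFintype_map_equiv (Equiv.mulLeft (r ^ x.val)), PMF.map_comp]
    rw [PMF.map_comp]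
    congr 1
    funext r'
    exact paillierEncWith_pow_mul N w x s r r'
  simp only [Function.comp_def] at this ⊢
  simp only [this, PMF.bind_const]

/-! ### Shifting the shares -/

open Classical in
/-- A legal play leaves room for a shift of the shares which is invisible in everything that
was revealed and which turns one challenge into the other. -/
theorem Legal.exists_shift {M T : ℕ} {X : Type} [CommRing X] {ch : Challenge M T X}
    {L : Log M T X} (h : Legal ch L) :
    ∃ δ : Fin M → Fin T → X,
      (∀ i, some i ∈ L.corrupted → δ i = 0) ∧
      (none ∈ L.corrupted → ∀ t, ∑ i, δ i t = 0) ∧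
      (∀ q ∈ L.queries, δ q.agent q.time = 0) ∧
      ∀ i, some i ∈ ch.S →
        δ i ch.time = ch.w false i * ch.x false i - ch.w true i * ch.x true i := by
  set d : Fin M → X := fun i => ch.w false i * ch.x false i - ch.w true i * ch.x true i with hd
  -- It suffices to shift at the challenge time. A compromised aggregator knows the sum of the
  -- shares, so the shift must then sum to zero. If `S⋆ = 𝒰⋆` this is the balance rule.
  obtain ⟨e, he_out, he_sum, he⟩ : ∃ e : Fin M → X,
      (∀ i, some i ∉ L.untouched ch.time → e i = 0) ∧ (none ∈ L.corrupted → ∑ i, e i = 0) ∧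
      ∀ i, some i ∈ ch.S → e i = d i := by
    by_cases hn : none ∈ L.corrupted
    · have hnU : none ∉ L.untouched ch.time := by simp [Log.untouched, hn]
      have hnS : none ∉ ch.S := fun hc => hnU (h.subset hc)
      by_cases hS : ch.S = L.untouched ch.time
      · refine ⟨fun i => if some i ∈ ch.S then d i else 0, fun i hi => if_neg (hS ▸ hi), ?_,
          fun i hi => if_pos hi⟩
        intro _
        rw [← Finset.sum_filter, hd, Finset.sum_sub_distrib, sub_eq_zero]
        convert h.balanced hS hnS
      · obtain ⟨j, hjU, hjS⟩ := Finset.exists_of_ssubset (h.subset.ssubset_of_ne hS)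
        obtain - | j := j
        · exact absurd hjU hnU
        -- An untouched agent `j` outside `S⋆` absorbs the imbalance: neither its key nor a
        -- ciphertext at this time is revealed.
        refine ⟨fun i => if some i ∈ ch.S then d i else
          if i = j then -∑ i with some i ∈ ch.S, d i else 0, ?_, ?_, fun i hi => if_pos hi⟩
        · intro i hi
          dsimp only
          rw [if_neg fun hc => hi (h.subset hc), if_neg]
          rintro rfl
          exact hi hjU
        · intro _
          rw [Finset.sum_ite, Finset.sum_ite_eq' _ j, if_pos (by simpa using hjS),
            add_neg_cancel]
    · exact ⟨fun i => if some i ∈ ch.S then d i else 0,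
        fun i hi => if_neg fun hc => hi (h.subset hc), fun hc => absurd hc hn,
        fun i hi => if_pos hi⟩
  refine ⟨fun i t => if t = ch.time then e i else 0, ?_, ?_, ?_, ?_⟩
  · intro i hi
    funext t
    simp [he_out i (by simp [Log.untouched, hi])]
  · intro hn t
    by_cases ht : t = ch.time
    · simpa [ht] using he_sum hn
    · simp [ht]
  · intro q hq
    by_cases ht : q.time = ch.time
    · have : some q.agent ∈ L.encrypted ch.time := by
        simp only [Log.encrypted, List.mem_toFinset, List.mem_map, List.mem_filter,
          decide_eq_true_eq]
        exact ⟨q, ⟨hq, ht⟩, rfl⟩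
      simp [he_out q.agent (by simp [Log.untouched, this])]
    · simp [ht]
  · intro i hi
    simp [he i hi, hd]

/-! ### The game with arbitrary shares -/

section Shares

variable {M T : ℕ}

open Classical in
/-- The challenger of the scheme, for arbitrary shares in `ℤ/N`; a key is
replaced by a dummy at those time steps where the share is not a unit. -/
noncomputable def shareOracle (N : ℕ+) (s : Fin M → Fin T → ZMod N) :
    Oracle M T (ZMod N) (Fin T → (ZMod N)ˣ) ((ℕ × ZMod N) × (Fin T → ZMod N))
      (ZMod ((N : ℕ) ^ 2)) where
  key i t := if h : IsUnit (s i t) then h.unit else 1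
  aggr := (paillierSecret N, fun t => -∑ i, s i t)
  enc i t w x := paillierEnc N (w * x + s i t)

/-- The interactions with the scheme for the modulus `N`. -/
abbrev PaillierInteraction (M T : ℕ) (N : ℕ+) (R : Type) : Type :=
  Interaction M T (ZMod N) (Fin T → (ZMod N)ˣ) ((ℕ × ZMod N) × (Fin T → ZMod N))
    (ZMod ((N : ℕ) ^ 2)) R

/-- The adversaries against the scheme for the modulus `N`. -/
abbrev PaillierAdversary (M T : ℕ) (N : ℕ+) : Type :=
  PaillierInteraction M T N (Challenge M T (ZMod N) ×
    ((Fin M → Option (ZMod ((N : ℕ) ^ 2))) → PaillierInteraction M T N Bool))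

/-- On the challenged agents `w⁰x⁰ + s = w¹x¹ + (s + δ)`, so the ciphertext laws coincide. The key
of agent `i` depends on `s i` alone, so the dummy values do no harm. -/
theorem shareOracle_play_add (N : ℕ+) (I : PaillierAdversary M T N)
    {o : Challenge M T (ZMod N) × Bool × Log M T (ZMod N)} {δ : Fin M → Fin T → ZMod N}
    (hkey : ∀ i, some i ∈ o.2.2.corrupted → δ i = 0)
    (haggr : none ∈ o.2.2.corrupted → ∀ t, ∑ i, δ i t = 0)
    (henc : ∀ q ∈ o.2.2.queries, δ q.agent q.time = 0)
    (hch : ∀ i, some i ∈ o.1.S →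
      δ i o.1.time = o.1.w false i * o.1.x false i - o.1.w true i * o.1.x true i)
    (s : Fin M → Fin T → ZMod N) :
    (shareOracle N s).play I false o = (shareOracle N (s + δ)).play I true o := by
  apply Oracle.AgreeOn.play_apply_eq
  · refine ⟨fun i hi => ?_, fun hn => ?_, fun q hq => ?_⟩
    · simp [shareOracle, hkey i hi]
    · simp [shareOracle, Finset.sum_add_distrib, haggr hn]
    · simp [shareOracle, henc q hq]
  · unfold Oracle.answer
    congr 1
    funext i
    by_cases hi : some i ∈ o.1.S
    · simp only [if_pos hi, shareOracle, Pi.add_apply, hch i hi]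
      congr 2
      ring
    · simp only [if_neg hi]

open Classical in
/-- The outcome of the game: whether the guess is correct in a legal play, a coin toss
otherwise. -/
noncomputable def verdict {X : Type} [CommRing X] (o : Challenge M T X × Bool × Log M T X)
    (b : Bool) : PMF Bool :=
  if Legal o.1 o.2.2 then PMF.pure (o.2.1 == b) else PMF.uniformOfFintype Bool

/-- The guess is part of `o`, so in a legal play exactly one bit gives the verdict `v`. Both bits
have equal weight after summing over the shares, and this produces the factor `2⁻¹`. -/
theorem sum_play_mul_verdict (N : ℕ+) (I : PaillierAdversary M T N) (v : Bool)
    (o : Challenge M T (ZMod N) × Bool × Log M T (ZMod N)) :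
    ∑ s, ∑ b, (shareOracle N s).play I b o * verdict o b v =
      2⁻¹ * ∑ s, ∑ b, (shareOracle N s).play I b o := by
  by_cases h : Legal o.1 o.2.2
  · obtain ⟨δ, h₁, h₂, h₃, h₄⟩ := h.exists_shift
    have hs : ∑ s, (shareOracle N s).play I false o = ∑ s, (shareOracle N s).play I true o := by
      -- `δ` depends on `o` but not on `s`, so `s ↦ s + δ` is a bijection of the shares.
      rw [← Equiv.sum_comp (Equiv.addRight δ) fun s => (shareOracle N s).play I true o]
      exact Finset.sum_congr rfl fun s _ => shareOracle_play_add N I h₁ h₂ h₃ h₄ s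
    simp only [Fintype.sum_bool, Finset.sum_add_distrib, ← Finset.sum_mul, hs, ← two_mul]
    rw [← mul_assoc, ENNReal.inv_mul_cancel two_ne_zero ENNReal.ofNat_ne_top, one_mul,
      ← mul_add, verdict, verdict, if_pos h, if_pos h]
    cases o.2.1 <;> cases v <;> simp [PMF.pure_apply]
  · simp [verdict, h, Finset.mul_sum, Finset.sum_add_distrib, mul_comm, mul_add]

/-- The game for fixed shares. -/
noncomputable def shareGame (N : ℕ+) (I : PaillierAdversary M T N)
    (s : Fin M → Fin T → ZMod N) : PMF Bool :=
  (PMF.uniformOfFintype Bool).bind fun b => ((shareOracle N s).play I b).bind fun o => verdict o b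

theorem shareGame_apply (N : ℕ+) (I : PaillierAdversary M T N)
    (s : Fin M → Fin T → ZMod N) (v : Bool) :
    shareGame N I s v = 2⁻¹ * ∑' o, ∑ b, (shareOracle N s).play I b o * verdict o b v := by
  simp only [shareGame, PMF.bind_apply, PMF.uniformOfFintype_apply, Fintype.card_bool,
    tsum_fintype (L := .unconditional _), Fintype.sum_bool, Nat.cast_ofNat, ← mul_add]
  rw [ENNReal.tsum_add]

/-- With uniform shares in `ℤ/N` the game is a fair coin toss. -/
theorem sum_shareGame (N : ℕ+) (I : PaillierAdversary M T N) (v : Bool) :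
    ∑ s, shareGame N I s v =
      2⁻¹ * (Fintype.card (Fin M → Fin T → ZMod N) : ℝ≥0∞) := by
  have hone : ∀ s b, ∑' o, (shareOracle N s).play I b o = 1 := fun s b => PMF.tsum_coe _
  simp only [shareGame_apply, ← Finset.mul_sum]
  rw [← Summable.tsum_finsetSum fun _ _ => ENNReal.summable]
  simp only [sum_play_mul_verdict, ENNReal.tsum_mul_left]
  rw [Summable.tsum_finsetSum fun _ _ => ENNReal.summable]
  simp only [Fintype.sum_bool, ENNReal.tsum_add, hone]
  simp only [Finset.sum_const, Finset.card_univ, nsmul_eq_mul, one_add_one_eq_two]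
  congr 1
  rw [mul_comm, mul_assoc, ENNReal.mul_inv_cancel two_ne_zero ENNReal.ofNat_ne_top, mul_one]

/-- The game of the scheme for a fixed modulus. -/
noncomputable def unitGame (N : ℕ+) (I : PaillierAdversary M T N) : PMF Bool :=
  (PMF.uniformOfFintype (Fin M → Fin T → (ZMod N)ˣ)).bind fun s =>
    shareGame N I fun i t => (s i t : ZMod N)

/-- Unit tuples embed into all tuples, and the remaining terms of the sum are nonnegative. -/
theorem unitGame_apply_mul_le (N : ℕ+) (I : PaillierAdversary M T N) (v : Bool) :
    unitGame N I v * (Fintype.card (Fin M → Fin T → (ZMod N)ˣ) : ℝ≥0∞) ≤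
      2⁻¹ * (Fintype.card (Fin M → Fin T → ZMod N) : ℝ≥0∞) := by
  have hc : (Fintype.card (Fin M → Fin T → (ZMod N)ˣ) : ℝ≥0∞) ≠ 0 := by
    exact_mod_cast Fintype.card_ne_zero
  have hinj : Function.Injective
      fun (s : Fin M → Fin T → (ZMod N)ˣ) i t => (s i t : ZMod N) := by
    intro s s' h
    funext i t
    exact Units.ext (congrFun (congrFun h i) t)
  rw [unitGame, PMF.bind_apply, tsum_fintype (L := .unconditional _)]
  simp only [PMF.uniformOfFintype_apply]
  rw [← Finset.mul_sum, mul_comm, ← mul_assoc,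
    ENNReal.mul_inv_cancel hc (ENNReal.natCast_ne_top _), one_mul, ← sum_shareGame N I v]
  have himg := Finset.sum_image (f := fun s => shareGame N I s v) (s := Finset.univ) hinj.injOn
  rw [← himg]
  exact Finset.sum_le_sum_of_subset (Finset.subset_univ _)

theorem unitGame_apply_le (N : ℕ+) (I : PaillierAdversary M T N) (v : Bool) :
    (unitGame N I v).toReal ≤ 1 / 2 + (M * T : ℕ) * (1 - (Nat.totient N : ℝ) / N) := by
  have hN : (0 : ℝ) < N := by exact_mod_cast N.pos
  set g := (unitGame N I v).toReal with hg
  have hg1 : g ≤ 1 := by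
    have := ENNReal.toReal_mono ENNReal.one_ne_top (PMF.coe_le_one (unitGame N I) v)
    simpa using this
  have hle := ENNReal.toReal_mono
    (ENNReal.mul_ne_top (by simp) (ENNReal.natCast_ne_top _)) (unitGame_apply_mul_le N I v)
  simp only [ENNReal.toReal_mul, Fintype.card_fun, Fintype.card_fin,
    ZMod.card_units_eq_totient, ZMod.card, ENNReal.toReal_inv, ENNReal.toReal_ofNat,
    ← pow_mul, Nat.cast_pow, ENNReal.toReal_pow,
    ENNReal.toReal_natCast, ← hg] at hle
  set y : ℝ := (Nat.totient N : ℝ) / N with hy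
  have hy0 : 0 ≤ y := by positivity
  have hy1 : y ≤ 1 := (div_le_one hN).2 (by exact_mod_cast Nat.totient_le N)
  have hgy : g * y ^ (M * T) ≤ 1 / 2 := by
    rw [hy, div_pow, ← mul_div_assoc, div_le_iff₀ (by positivity), mul_comm M T]
    linarith
  -- Bernoulli's inequality. With `n = M * T`, it finishes via `g = g * y ^ n + g * (1 - y ^ n) ≤
  -- 1/2 + (1 - y ^ n)`.
  have hb : 1 + ((M * T : ℕ) : ℝ) * (y - 1) ≤ y ^ (M * T) := by
    have := one_add_mul_le_pow (a := y - 1) (by linarith) (M * T)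
    simpa using this
  have hp1 : y ^ (M * T) ≤ 1 := pow_le_one₀ hy0 hy1
  nlinarith [mul_le_of_le_one_left (sub_nonneg.2 hp1) hg1]

end Shares

/-! ### The game of the scheme -/

theorem pWSAh_freshEnc (gen : PMF PaillierPrimes) (κ M T : ℕ) (prm : ℕ × ℕ+)
    (s : Fin M → Fin T → (ZMod prm.2)ˣ) (i : Fin M) (t : Fin T) (w x : ZMod prm.2) :
    (pWSAh gen κ M T).freshEnc prm s i t w x = paillierEnc prm.2 (w * x + (s i t : ZMod prm.2)) :=
  paillierEnc_bind prm.2 w x (s i t)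

theorem shareOracle_units {M T : ℕ} (gen : PMF PaillierPrimes) (κ : ℕ) (prm : ℕ × ℕ+)
    (s : Fin M → Fin T → (ZMod prm.2)ˣ) :
    shareOracle prm.2 (fun i t => (s i t : ZMod prm.2)) =
      ⟨s, (paillierSecret prm.2, aggregatorShare prm.2 s), (pWSAh gen κ M T).freshEnc prm s⟩ := by
  unfold shareOracle
  congr 1
  · funext i t
    rw [dif_pos (s i t).isUnit]
    exact Units.ext rfl
  · funext i t w x
    exact (pWSAh_freshEnc gen κ M T prm s i t w x).symm

/-- The phase before the challenge does not use the bit, so the bit can be drawn first. -/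
theorem Scheme.game_eq {M T : ℕ} (𝒮 : Scheme M T) (A : 𝒮.Adversary) :
    𝒮.game A = 𝒮.setup.bind fun keys => (PMF.uniformOfFintype Bool).bind fun b =>
      (Oracle.play ⟨keys.2.1, keys.2.2, 𝒮.freshEnc keys.1 keys.2.1⟩ (A keys.1) b).bind fun o =>
        verdict o b := by
  unfold Scheme.game
  congr 1
  funext keys
  rw [PMF.bind_comm]
  simp only [Scheme.run_eq, Oracle.play, PMF.bind_bind, PMF.pure_bind]
  rfl

theorem pWSAh_game (gen : PMF PaillierPrimes) (κ M T : ℕ) (A : (pWSAh gen κ M T).Adversary) :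
    (pWSAh gen κ M T).game A = gen.bind fun k => unitGame k.modulus (A (κ, k.modulus)) := by
  rw [Scheme.game_eq]
  refine (PMF.bind_bind _ _ _).trans (congrArg gen.bind (funext fun k => ?_))
  refine (PMF.bind_map _ _ _).trans (congrArg (PMF.bind _) (funext fun s => ?_))
  unfold shareGame
  rw [shareOracle_units gen κ (κ, k.modulus) s]
  rfl

theorem toReal_bind_apply_le {α β : Type} (p : PMF α) (f : α → PMF β) (b : β) {c : ℝ}
    (hc : 0 ≤ c) (h : ∀ a ∈ p.support, (f a b).toReal ≤ c) : (p.bind f b).toReal ≤ c := by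
  refine ENNReal.toReal_le_of_le_ofReal hc ?_
  rw [PMF.bind_apply]
  calc ∑' a, p a * f a b ≤ ∑' a, p a * ENNReal.ofReal c := by
        refine ENNReal.tsum_le_tsum fun a => ?_
        by_cases ha : p a = 0
        · simp [ha]
        · gcongr
          rw [← ENNReal.ofReal_toReal (PMF.apply_ne_top (f a) b)]
          exact ENNReal.ofReal_le_ofReal (h a ((PMF.mem_support_iff _ _).2 ha))
    _ = ENNReal.ofReal c := by rw [ENNReal.tsum_mul_right, PMF.tsum_coe, one_mul]

/-- The two probabilities sum to one, so upper bounds on both give a two-sided bound. This is why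
the estimates above are made for an arbitrary verdict `v`. -/
theorem abs_toReal_sub_half_le (p : PMF Bool) {ε : ℝ}
    (h : ∀ v, (p v).toReal ≤ 1 / 2 + ε) : |(p true).toReal - 1 / 2| ≤ ε := by
  have hsum : (p true).toReal + (p false).toReal = 1 := by
    rw [← ENNReal.toReal_add (PMF.apply_ne_top _ _) (PMF.apply_ne_top _ _), ← Fintype.sum_bool,
      ← tsum_fintype (L := .unconditional _), PMF.tsum_coe, ENNReal.toReal_one]
  rw [abs_le]
  constructor <;> linarith [h true, h false]

/-! ### The density of the units -/

/-- Equal bit length forces `q < 2 * p`, whence `2 ^ κ ≤ p * q ≤ (2 * p) ^ 2`. -/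
theorem sqrt_two_pow_le_two_mul {κ p q : ℕ} (hsize : p.size = q.size)
    (hκ : 2 ^ κ ≤ p * q) : √2 ^ κ ≤ 2 * (p : ℝ) := by
  have hq : q < 2 * p := by
    have h1 : q < 2 ^ p.size := hsize ▸ Nat.lt_size_self q
    have hp0 : p ≠ 0 := by
      rintro rfl
      simp at hκ
    obtain ⟨n, hn⟩ := Nat.exists_eq_succ_of_ne_zero
      (Nat.size_pos.2 (Nat.pos_of_ne_zero hp0)).ne'
    have h2 : 2 ^ n ≤ p := Nat.lt_size.1 (by omega)
    rw [hn, Nat.succ_eq_add_one, pow_succ] at h1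
    omega
  have h : 2 ^ κ ≤ (2 * p) ^ 2 := by nlinarith
  have h' : (√2 ^ κ) ^ 2 ≤ (2 * (p : ℝ)) ^ 2 := by
    rw [← pow_mul, mul_comm, pow_mul, Real.sq_sqrt (by norm_num)]
    exact_mod_cast h
  exact le_of_sq_le_sq h' (by positivity)

/-- If `p = q`, then `p` divides both `φ(p²) = p * φ(p)` and `p²`, against coprimality. -/
theorem PaillierPrimes.ne (k : PaillierPrimes) : k.p ≠ k.q := by
  intro h
  have hc := k.coprime
  rw [← h, Nat.totient_mul_of_prime_of_dvd k.prime_p dvd_rfl] at hc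
  have h1 : k.p ∣ Nat.gcd (k.p * Nat.totient k.p) (k.p * k.p) :=
    Nat.dvd_gcd (Nat.dvd_mul_right _ _) (Nat.dvd_mul_right _ _)
  rw [hc] at h1
  exact k.prime_p.one_lt.ne' (Nat.dvd_one.1 h1)

theorem PaillierPrimes.one_sub_totient_div_le (k : PaillierPrimes) {κ : ℕ}
    (hκ : Nat.log 2 (k.p * k.q) = κ) :
    1 - (Nat.totient k.modulus : ℝ) / k.modulus ≤ 4 / √2 ^ κ := by
  have hN : 2 ^ κ ≤ k.p * k.q := by
    rw [← hκ]
    exact Nat.pow_log_le_self 2 (Nat.mul_pos k.prime_p.pos k.prime_q.pos).ne'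
  have hp0 : (0 : ℝ) < k.p := by exact_mod_cast k.prime_p.pos
  have hq0 : (0 : ℝ) < k.q := by exact_mod_cast k.prime_q.pos
  have hr : (0 : ℝ) < √2 ^ κ := by positivity
  have hp : 1 / (k.p : ℝ) ≤ 2 / √2 ^ κ := by
    rw [div_le_div_iff₀ hp0 hr]
    linarith [sqrt_two_pow_le_two_mul k.equal_size hN]
  have hq : 1 / (k.q : ℝ) ≤ 2 / √2 ^ κ := by
    rw [div_le_div_iff₀ hq0 hr]
    linarith [sqrt_two_pow_le_two_mul k.equal_size.symm (mul_comm k.p k.q ▸ hN)]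
  have htot : (Nat.totient k.modulus : ℝ) = (k.p - 1) * (k.q - 1) := by
    change (Nat.totient (k.p * k.q) : ℝ) = _
    rw [Nat.totient_mul ((Nat.coprime_primes k.prime_p k.prime_q).2 k.ne),
      Nat.totient_prime k.prime_p, Nat.totient_prime k.prime_q]
    push_cast [k.prime_p.one_le, k.prime_q.one_le]
    ring
  have hmod : ((k.modulus : ℕ) : ℝ) = k.p * k.q := by
    change ((k.p * k.q : ℕ) : ℝ) = _
    push_cast
    rfl
  have : 1 - (Nat.totient k.modulus : ℝ) / k.modulus =
      1 / k.p + 1 / k.q - 1 / (k.p * k.q) := by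
    rw [htot, hmod]
    field_simp
    ring
  have h0 : 0 < 1 / ((k.p : ℝ) * k.q) := by positivity
  have h4 : (4 : ℝ) / √2 ^ κ = 2 / √2 ^ κ + 2 / √2 ^ κ := by ring
  linarith

theorem pWSAh_advantage_le (gen : PMF PaillierPrimes) (κ M T : ℕ)
    (hgen : ∀ k ∈ gen.support, Nat.log 2 (k.p * k.q) = κ) (A : (pWSAh gen κ M T).Adversary) :
    (pWSAh gen κ M T).advantage A ≤ (M * T : ℕ) * (4 / √2 ^ κ) := by
  refine abs_toReal_sub_half_le _ fun v => ?_
  rw [pWSAh_game]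
  refine toReal_bind_apply_le _ _ _ (by positivity) fun k hk => ?_
  refine (unitGame_apply_le _ _ v).trans ?_
  gcongr
  exact k.one_sub_totient_div_le (hgen k hk)

/-! ### Negligibility -/

theorem negligible_of_eventually_le {f : ℕ → ℝ} (P : Polynomial ℝ) {r : ℝ} (hr : 1 < r)
    (hf : ∀ᶠ n in Filter.atTop, |f n| ≤ P.eval (n : ℝ) / r ^ n) : Negligible f := by
  intro c hc
  obtain ⟨m, hm⟩ := exists_nat_ge c
  have hO : (fun n : ℕ => P.eval (n : ℝ)) =O[Filter.atTop] fun n : ℕ => (n : ℝ) ^ P.natDegree := by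
    have := (Polynomial.isBigO_atTop_of_degree_le P (Polynomial.X ^ P.natDegree)
      (by simp [Polynomial.degree_le_natDegree])).comp_tendsto
        (tendsto_natCast_atTop_atTop (R := ℝ))
    simpa [Function.comp_def] using this
  obtain ⟨C, hC0, hC⟩ := hO.exists_pos
  -- The extra `m ≥ c` powers of `n` leave a factor `n ^ (-m) ≤ n ^ (-c)` once this quotient is at
  -- most one.
  have ht := (tendsto_pow_const_div_const_pow_of_one_lt (P.natDegree + m) hr).const_mul C
  rw [mul_zero] at ht
  obtain ⟨n₀, hn₀⟩ := Filter.eventually_atTop.1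
    ((hf.and hC.bound).and (ht.eventually_le_const one_pos))
  refine ⟨max n₀ 1, le_max_right _ _, fun n hn => ?_⟩
  obtain ⟨⟨h1, h2⟩, h3⟩ := hn₀ n ((le_max_left _ _).trans hn)
  have hn1 : (1 : ℝ) ≤ n := by exact_mod_cast (le_max_right _ _).trans hn
  have hn0 : (0 : ℝ) < n := by linarith
  have hrn : 0 < r ^ n := by positivity
  rw [Real.norm_of_nonneg (by positivity : (0 : ℝ) ≤ (n : ℝ) ^ P.natDegree)] at h2
  calc |f n| ≤ P.eval (n : ℝ) / r ^ n := h1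
    _ ≤ C * (n : ℝ) ^ P.natDegree / r ^ n := by
        gcongr
        exact (le_abs_self _).trans h2
    _ = C * ((n : ℝ) ^ (P.natDegree + m) / r ^ n) * ((n : ℝ) ^ m)⁻¹ := by
        rw [pow_add]
        field_simp
    _ ≤ ((n : ℝ) ^ m)⁻¹ := mul_le_of_le_one_left (by positivity) h3
    _ = (n : ℝ) ^ (-(m : ℝ)) := by rw [Real.rpow_neg hn0.le, Real.rpow_natCast]
    _ ≤ (n : ℝ) ^ (-c) := Real.rpow_le_rpow_of_exponent_le hn1 (by linarith)

end PWSA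

theorem theorem1 (M T : ℕ → ℕ) (hM : PWSA.PolyBounded M) (hT : PWSA.PolyBounded T)
    (gen : ℕ → PMF PWSA.PaillierPrimes)
    (hgen : ∀ᶠ κ in Filter.atTop, ∀ k ∈ (gen κ).support, Nat.log 2 (k.p * k.q) = κ) :
    PWSA.AggregatorOblivious fun κ => PWSA.pWSAh (gen κ) κ (M κ) (T κ) := by
  intro A
  -- Taking the advantage itself as `η` leaves only an asymptotic bound to prove, so the small `κ`
  -- not covered by `hgen` are irrelevant.
  refine ⟨fun κ => (PWSA.pWSAh (gen κ) κ (M κ) (T κ)).advantage (A κ), ?_, fun κ => le_rfl⟩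
  obtain ⟨P, hP⟩ := hM
  obtain ⟨Q, hQ⟩ := hT
  refine PWSA.negligible_of_eventually_le
    (4 * (P * Q).map (Nat.castRingHom ℝ)) (r := √2) ?_ ?_
  · rw [Real.lt_sqrt] <;> norm_num
  · filter_upwards [hgen] with κ hκ
    refine (abs_abs _).trans_le ?_
    refine (PWSA.pWSAh_advantage_le _ _ _ _ hκ _).trans ?_
    have hPQ : ((M κ * T κ : ℕ) : ℝ) ≤ ((P.eval κ * Q.eval κ : ℕ) : ℝ) := by
      exact_mod_cast Nat.mul_le_mul (hP κ) (hQ κ)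
    have he : (4 * (P * Q).map (Nat.castRingHom ℝ)).eval (κ : ℝ) =
        4 * ((P.eval κ * Q.eval κ : ℕ) : ℝ) := by
      rw [Polynomial.eval_mul, Polynomial.eval_natCast_map, Polynomial.eval_mul]
      simp
    rw [he, mul_div_assoc', mul_comm]
    gcongr
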